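/- **Definitions.** A *commutative regular quasi-semiring* (cr-qsring) is an algebra $(R,+,\bullet,-,{}^{-1},\varepsilon)$ of signature $(2,2,1,1,0)$ such that $(R,+)$ and $(R,\bullet)$ are commutative regular semigroups with quasi-inverses $-x$ and $x^{-1}$ (that is, $x+(-x)+x=x$, $(-x)+x+(-x)=-x$, $x\bullet x^{-1}\bullet x=x$, $x^{-1}\bullet x\bullet x^{-1}=x^{-1}$) and, writing $e^+(x):=x+(-x)$, $E^+:=\{x : x+x=x\}$, $E^\bullet:=\{x : x\bullet x=x\}$ and $x\le y :\Leftrightarrow x=y+e^+(x)$ (a partial order): - $E^+\cap E^\bullet=\{\varepsilon\}$; - $x\bullet y+x\bullet z\le x\bullet(y+z)$ for all $x,y,z$; - $y\le z$ implies $x\bullet y\le x\bullet z$; - $-(x\bullet y)=x\bullet(-y)$; - $e^+(x+y)\le e^+(x\bullet y)$ for all $x,y\in E^\bullet$. Put $\Lambda:=E^+$ (an Abelian $l$-group under $\bullet$ with neutral element $\varepsilon$ and order $\le$), $\Lambda_+:=\{\alpha\in\Lambda:\varepsilon\le\alpha\}$ and $v(x):=\varepsilon\bullet x\in\Lambda$.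 The cr-qsring $R$ is *directed* if $\varepsilon\le x$ for all $x\in E^\bullet$. A directed $R$ is *superrigid* if the (injective) map $e^+|_{E^\bullet}:E^\bullet\to\Lambda_+$ is surjective; then $1_\alpha$ denotes the unique element of $E^\bullet$ with $e^+(1_\alpha)=\alpha$. A directed $R$ is *spherically complete* if for every $x\in R$ there is a map $\varphi:\Lambda\to R$ with $e^+(\varphi(\alpha))=\alpha$ for all $\alpha\in\Lambda$, $\varphi(\alpha)\le\varphi(\beta)$ whenever $\alpha\le\beta$, and $\varphi(e^+(x))=x$. For a superrigid directed cr-qsring $R$, let $B=B(R)$ be the set of all maps $\varphi:\Lambda_+\to R$ with $e^+(\varphi(\alpha))=\alpha$ for all $\alpha\in\Lambda_+$ and $\varphi(\alpha)\le\varphi(\beta)$ for $\alpha\le\beta$. It is a commutative unital ring with pointwise $+$ and $-$, zero $\alpha\mapsto\alpha$, unit $\alpha\mapsto 1_\alpha$, and product $$(\varphi\cdot\psi)(\alpha)=\varphi\bigl(\alpha\bullet v(\psi(\varepsilon))^{-1}\bigr)\bullet\psi\bigl(\alpha\bullet v(\varphi(\varepsilon))^{-1}\bigr)+\alpha .$$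 Let $w(\varphi):=v\circ\varphi$ and let $A:=\{\varphi\in B : w(\varphi)(\alpha)\ge\varepsilon\text{ for all }\alpha\in\Lambda_+\}=\{\varphi\in B:\varphi(\varepsilon)=\varepsilon\}$, a subring of $B$. The ring extension associated to $R$ is $A\subseteq B$. A commutative ring extension $A\subseteq B$ is a *Prüfer extension* if the invertible $A$-submodules of $B$ (the $A$-submodules $I\subseteq B$ with $IJ=A$ for some $A$-submodule $J\subseteq B$) are exactly the finitely generated $A$-submodules $I\subseteq B$ with $IB=B$. **Corollary 6.9.** Let $R$ be a superrigid directed cr-qsring. If $R$ is spherically complete, then $R$ is Prüfer, i.e. its associated ring extension $A\subseteq B$ is a Prüfer extension. -/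

import Mathlib

/-- The canonical relation attached to an addition and a quasi-inverse:
`x ≤ y` means `x = y + e⁺(x)`, where `e⁺(x) = x + (-x)`. -/
def crAddLE {R : Type*} [Add R] [Neg R] (x y : R) : Prop :=
  x = y + (x + -x)

/-- A commutative regular quasi-semiring (cr-qsring).  The multiplication `•` is written `*`. -/
class CRQSring (R : Type*) extends AddCommSemigroup R, CommSemigroup R, Neg R, Inv R where
  /-- the distinguished constant -/
  eps : R
  add_neg_add : ∀ x : R, x + -x + x = x
  neg_add_neg : ∀ x : R, -x + x + -x = -x
  mul_inv_mul : ∀ x : R, x * x⁻¹ * x = x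
  inv_mul_inv : ∀ x : R, x⁻¹ * x * x⁻¹ = x⁻¹
  idem_iff : ∀ x : R, (x + x = x ∧ x * x = x) ↔ x = eps
  quasi_distrib : ∀ x y z : R, crAddLE (x * y + x * z) (x * (y + z))
  mul_mono : ∀ x y z : R, crAddLE y z → crAddLE (x * y) (x * z)
  neg_mul_right : ∀ x y : R, -(x * y) = x * -y
  idem_add_le : ∀ x y : R, x * x = x → y * y = y →
    crAddLE ((x + y) + -(x + y)) (x * y + -(x * y))

namespace CRQSring

section Basic

variable {R : Type*} [CRQSring R]

/-- `e⁺(x) = x + (-x)`. -/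
def ep (x : R) : R := x + -x

/-- `e•(x) = x • x⁻¹`. -/
def eb (x : R) : R := x * x⁻¹

/-- The quasivaluation `v(x) = ε • x`. -/
def v (x : R) : R := eps * x

theorem ep_add_self (x : R) : ep x + x = x := add_neg_add x

theorem add_ep_self (x : R) : x + ep x = x := by rw [add_comm]; exact add_neg_add x

theorem ep_idem (x : R) : ep x + ep x = ep x := by
  unfold ep; rw [← add_assoc, add_neg_add]

theorem neg_unique {x y : R} (h1 : x + y + x = x) (h2 : y + x + y = y) : y = -x := by
  have a : y = y + x + -x + (x + y) := by
    calc y = y + x + y := h2.symm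
      _ = y + (x + -x + x) + y := by rw [add_neg_add]
      _ = _ := by ac_rfl
  have b : -x = -x + x + y + (x + -x) := by
    calc -x = -x + x + -x := (neg_add_neg x).symm
      _ = -x + (x + y + x) + -x := by rw [h1]
      _ = _ := by ac_rfl
  have c : y + x + -x + (x + y) = (x + y + x) + (-x + y) := by ac_rfl
  have d : -x + x + y + (x + -x) = (x + -x + x) + (-x + y) := by ac_rfl
  exact (a.trans c).trans (Eq.trans (by rw [h1, add_neg_add]) (b.trans d).symm)

theorem inv_unique {x y : R} (h1 : x * y * x = x) (h2 : y * x * y = y) : y = x⁻¹ := by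
  have a : y = (x * y * x) * (x⁻¹ * y) := by
    calc y = y * x * y := h2.symm
      _ = y * (x * x⁻¹ * x) * y := by rw [mul_inv_mul]
      _ = _ := by ac_rfl
  have b : x⁻¹ = (x * x⁻¹ * x) * (x⁻¹ * y) := by
    calc x⁻¹ = x⁻¹ * x * x⁻¹ := (inv_mul_inv x).symm
      _ = x⁻¹ * (x * y * x) * x⁻¹ := by rw [h1]
      _ = _ := by ac_rfl
  exact a.trans (Eq.trans (by rw [h1, mul_inv_mul]) b.symm)

theorem neg_idem {f : R} (hf : f + f = f) : -f = f := (neg_unique (by simp [hf]) (by simp [hf])).symm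

theorem ep_of_idem {f : R} (hf : f + f = f) : ep f = f := by rw [ep, neg_idem hf, hf]

theorem neg_add' (x y : R) : -(x + y) = -x + -y := by
  symm; apply neg_unique
  · calc x + y + (-x + -y) + (x + y) = (x + -x + x) + (y + -y + y) := by ac_rfl
      _ = _ := by rw [add_neg_add, add_neg_add]
  · calc -x + -y + (x + y) + (-x + -y) = (-x + x + -x) + (-y + y + -y) := by ac_rfl
      _ = _ := by rw [neg_add_neg, neg_add_neg]

theorem ep_add (x y : R) : ep (x + y) = ep x + ep y := by
  unfold ep; rw [neg_add']; ac_rfl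

theorem ep_neg (x : R) : ep (-x) = ep x := by
  have : - -x = x := (neg_unique (neg_add_neg x) (add_neg_add x)).symm
  rw [ep, this, ep, add_comm]

/-- The canonical partial order `x ≤ y ↔ x = y + e⁺(x)`. -/
instance : PartialOrder R where
  le := crAddLE
  le_refl x := (add_ep_self x).symm
  le_trans x y z h1 h2 := by
    change x = y + ep x at h1
    change y = z + ep y at h2
    change x = z + ep x
    have e : ep x = ep y + ep x := by
      have := congrArg ep h1
      rwa [ep_add, ep_of_idem (ep_idem x)] at this
    calc x = z + ep y + ep x := by rw [← h2]; exact h1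
      _ = z + ep x := by rw [add_assoc, ← e]
  le_antisymm x y h1 h2 := by
    change x = y + ep x at h1
    change y = x + ep y at h2
    calc x = y + ep x := h1
      _ = x + ep x + ep y := by
          conv_lhs => rw [h2]
          ac_rfl
      _ = y := by rw [add_ep_self]; exact h2.symm

theorem le_def {x y : R} : x ≤ y ↔ x = y + ep x := Iff.rfl

/-- `Λ = E⁺`, the set of additive idempotents. -/
abbrev Lam (R : Type*) [CRQSring R] : Type _ := {f : R // f + f = f}

/-- `Λ₊`, the set of additive idempotents that are `≥ ε`. -/
abbrev LamPos (R : Type*) [CRQSring R] : Type _ := {f : R // f + f = f ∧ eps ≤ f}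

theorem le_of_add {x y f : R} (hf : f + f = f) (h : x = y + f) : x ≤ y := by
  rw [le_def]
  have e : ep x = ep y + f := by rw [h, ep_add, ep_of_idem hf]
  rw [e, ← add_assoc, add_ep_self, h]

theorem ep_le {x y : R} (h : x ≤ y) : ep x ≤ ep y := by
  refine le_of_add (ep_idem x) ?_
  have := congrArg ep (le_def.1 h)
  rwa [ep_add, ep_of_idem (ep_idem x)] at this

theorem add_mono {x y : R} (h : x ≤ y) (z : R) : x + z ≤ y + z := by
  refine le_of_add (ep_idem x) ?_
  conv_lhs => rw [le_def.1 h]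
  ac_rfl

theorem add_mono' {x y z t : R} (h : x ≤ y) (h' : z ≤ t) : x + z ≤ y + t := by
  refine (add_mono h z).trans ?_
  rw [add_comm y z, add_comm y t]
  exact add_mono h' y

theorem add_idem_le (x : R) {f : R} (hf : f + f = f) : x + f ≤ x := le_of_add hf rfl

theorem eq_of_le {x y : R} (h : x ≤ y) (h' : ep y ≤ ep x) : x = y := by
  have e := le_antisymm (ep_le h) h'
  rw [le_def.1 h, e, add_ep_self]

theorem idem_of_le {x f : R} (hf : f + f = f) (h : x ≤ f) : x + x = x := by
  have e : x + x = f + f + (ep x + ep x) := by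
    conv_lhs => rw [le_def.1 h]
    ac_rfl
  rw [e, hf, ep_idem, ← le_def.1 h]

theorem idem_add {f g : R} (hf : f + f = f) (hg : g + g = g) : (f + g) + (f + g) = f + g := by
  calc (f + g) + (f + g) = (f + f) + (g + g) := by ac_rfl
    _ = _ := by rw [hf, hg]

/-- On idempotents, `f ≤ g ↔ f + g = f`. -/
theorem add_of_le {f g : R} (hf : f + f = f) (h : f ≤ g) : f + g = f := by
  conv_rhs => rw [le_def.1 h, ep_of_idem hf]
  rw [add_comm]

theorem le_add {x f g : R} (hx : x + x = x) (h1 : x ≤ f) (h2 : x ≤ g) : x ≤ f + g := by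
  have := add_mono' h1 h2
  rwa [hx] at this

theorem mul_le (x : R) {y z : R} (h : y ≤ z) : x * y ≤ x * z := mul_mono x y z h

theorem mul_le' {x y z t : R} (h : x ≤ y) (h' : z ≤ t) : x * z ≤ y * t := by
  refine (mul_le x h').trans ?_
  rw [mul_comm x t, mul_comm y t]
  exact mul_le t h

theorem eps_add : (eps : R) + eps = eps := ((idem_iff (eps : R)).2 rfl).1

theorem eps_mul : (eps : R) * eps = eps := ((idem_iff (eps : R)).2 rfl).2

theorem inv_idem {f : R} (hf : f * f = f) : f⁻¹ = f := (inv_unique (by simp [hf]) (by simp [hf])).symm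

theorem eb_idem (x : R) : eb x * eb x = eb x := by
  unfold eb; rw [← mul_assoc, mul_inv_mul]

theorem mul_eb (x : R) : x * eb x = x := by rw [mul_comm]; exact mul_inv_mul x

theorem mul_idem_mul (x : R) {f : R} (hf : f + f = f) : x * f + x * f = x * f := by
  have h : x * f + x * f ≤ x * f := by
    have := quasi_distrib x f f
    rw [hf] at this; exact this
  have := le_def.1 h
  rw [ep_add, ep_idem, add_ep_self] at this
  exact this

theorem inv_mul' (x y : R) : (x * y)⁻¹ = x⁻¹ * y⁻¹ := by
  symm; apply inv_unique
  · calc x * y * (x⁻¹ * y⁻¹) * (x * y) = (x * x⁻¹ * x) * (y * y⁻¹ * y) := by ac_rfl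
      _ = _ := by rw [mul_inv_mul, mul_inv_mul]
  · calc x⁻¹ * y⁻¹ * (x * y) * (x⁻¹ * y⁻¹) = (x⁻¹ * x * x⁻¹) * (y⁻¹ * y * y⁻¹) := by ac_rfl
      _ = _ := by rw [inv_mul_inv, inv_mul_inv]

theorem eb_of_idem {f : R} (hf : f + f = f) : f * f⁻¹ = eps := by
  refine (idem_iff _).1 ⟨?_, eb_idem f⟩
  rw [mul_comm]; exact mul_idem_mul _ hf

theorem eps_mul_idem {f : R} (hf : f + f = f) : eps * f = f := by
  rw [← eb_of_idem hf, mul_inv_mul]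

theorem inv_add_idem {f : R} (hf : f + f = f) : f⁻¹ + f⁻¹ = f⁻¹ := by
  have : f⁻¹ = f⁻¹ * eps := by
    rw [← eb_of_idem hf, ← mul_assoc, inv_mul_inv]
  rw [this]; exact mul_idem_mul _ eps_add

theorem v_idem (x : R) : v x + v x = v x := by
  unfold v; rw [mul_comm]; exact mul_idem_mul _ eps_add

theorem v_of_idem {f : R} (hf : f + f = f) : v f = f := eps_mul_idem hf

theorem v_mul (x y : R) : v (x * y) = v x * v y := by
  unfold v
  calc eps * (x * y) = (eps * eps) * (x * y) := by rw [eps_mul]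
    _ = _ := by ac_rfl

theorem v_le {x y : R} (h : x ≤ y) : v x ≤ v y := mul_le _ h

theorem v_add (x y : R) : v x + v y ≤ v (x + y) := quasi_distrib _ _ _

theorem mul_idem_eq (x : R) {f : R} (hf : f + f = f) : x * f = v x * f := by
  unfold v
  calc x * f = x * (eps * f) := by rw [eps_mul_idem hf]
    _ = _ := by ac_rfl

theorem v_inv (x : R) : (v x)⁻¹ = v x⁻¹ := by
  unfold v; rw [inv_mul', inv_idem eps_mul]

theorem v_of_mul_idem {x : R} (hx : x * x = x) : v x = eps := by
  refine (idem_iff _).1 ⟨v_idem x, ?_⟩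
  rw [← v_mul, hx]

theorem neg_neg_mul (x : R) : -x * -x = x * x := by
  have nn : - -(x * x) = x * x := (neg_unique (neg_add_neg _) (add_neg_add _)).symm
  rw [← neg_mul_right, mul_comm, ← neg_mul_right, nn]

theorem v_neg (x : R) : v (-x) = v x := by
  unfold v; rw [← neg_mul_right]
  exact neg_idem (v_idem x)

theorem v_le_ep (x : R) : v x ≤ ep x := by
  have h := v_add x (-x)
  rw [v_neg, v_idem] at h
  change v x ≤ v (ep x) at h
  rwa [v_of_idem (ep_idem x)] at h

theorem ep_eq (x : R) : ep x = v x * ep (eb x) := by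
  apply le_antisymm
  · rw [← mul_idem_eq x (ep_idem _)]
    have h : x * eb x + x * -eb x ≤ x * (eb x + -eb x) := quasi_distrib _ _ _
    rw [← neg_mul_right, mul_eb] at h
    exact h
  · have h : x⁻¹ * x + x⁻¹ * -x ≤ x⁻¹ * (x + -x) := quasi_distrib _ _ _
    rw [← neg_mul_right, mul_comm x⁻¹ x] at h
    change ep (eb x) ≤ x⁻¹ * ep x at h
    refine (mul_le (v x) h).trans (le_of_eq ?_)
    rw [mul_idem_eq x⁻¹ (ep_idem x), ← v_inv, ← mul_assoc, eb_of_idem (v_idem x),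
      eps_mul_idem (ep_idem x)]

theorem ep_mul_of_mul_idem {x y : R} (hx : x * x = x) (hy : y * y = y) :
    ep (x * y) = ep x + ep y := by
  have key : ∀ {x y : R}, x * x = x → ep (x * y) ≤ ep y := by
    intro x y hx
    have h : x * y + x * -y ≤ x * (y + -y) := quasi_distrib _ _ _
    rw [← neg_mul_right] at h
    change ep (x * y) ≤ x * ep y at h
    rwa [mul_idem_eq x (ep_idem y), v_of_mul_idem hx, eps_mul_idem (ep_idem y)] at h
  apply le_antisymm
  · refine le_add (ep_idem _) ?_ (key hx)
    rw [mul_comm]; exact key hy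
  · rw [← ep_add]; exact idem_add_le x y hx hy

theorem mul_idem_add (x : R) {f g : R} (hf : f + f = f) (hg : g + g = g) :
    x * (f + g) = x * f + x * g := by
  apply le_antisymm
  · refine le_add (mul_idem_mul x (idem_add hf hg)) (mul_le x (add_idem_le f hg)) (mul_le x ?_)
    rw [add_comm]; exact add_idem_le g hf
  · exact quasi_distrib _ _ _

/-- Leibniz's rule. -/
theorem ep_mul (x y : R) : ep (x * y) = v x * ep y + v y * ep x := by
  have e : eb (x * y) = eb x * eb y := by unfold eb; rw [inv_mul']; ac_rfl
  rw [ep_eq (x * y), e, ep_mul_of_mul_idem (eb_idem x) (eb_idem y), v_mul,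
    mul_idem_add _ (ep_idem _) (ep_idem _), ep_eq y, ep_eq x, add_comm]
  congr 1 <;> ac_rfl

theorem neg_le {x y : R} (h : x ≤ y) : -x ≤ -y := by
  refine le_of_add (ep_idem x) ?_
  have := congrArg Neg.neg (le_def.1 h)
  rwa [neg_add', neg_idem (ep_idem x)] at this

/-- The binary meet for the canonical order. -/
def meet (x y : R) : R := x + v (x + -y)

theorem v_sub_comm (x y : R) : v (y + -x) = v (x + -y) := by
  have : - (x + -y) = y + -x := by
    have nn : - -y = y := (neg_unique (neg_add_neg _) (add_neg_add _)).symm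
    rw [neg_add', nn, add_comm]
  rw [← this, v_neg]

theorem v_sub_le (x y : R) : v (x + -y) ≤ ep x := by
  have h := v_le_ep (x + -y)
  rw [ep_add, ep_neg] at h
  exact h.trans (add_idem_le _ (ep_idem y))

theorem meet_le_left (x y : R) : meet x y ≤ x := add_idem_le x (v_idem _)

theorem ep_meet (x y : R) : ep (meet x y) = v (x + -y) := by
  unfold meet
  rw [ep_add, ep_of_idem (v_idem _), add_comm]
  exact add_of_le (v_idem _) (v_sub_le x y)

theorem le_meet {x y z : R} (h1 : z ≤ x) (h2 : z ≤ y) : z ≤ meet x y := by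
  have h := add_mono' h1 (neg_le h2)
  have h' := v_le h
  change v (ep z) ≤ _ at h'
  rw [v_of_idem (ep_idem z)] at h'
  have := add_mono' h1 h'
  rwa [add_ep_self] at this

end Basic

/-- A cr-qsring is directed when `ε ≤ x` for every multiplicative idempotent `x`. -/
class IsDirected (R : Type*) [CRQSring R] : Prop where
  eps_le : ∀ x : R, x * x = x → eps ≤ x

/-- A directed cr-qsring is superrigid when `e⁺ : E• → Λ₊` is surjective. -/
class IsSuperrigid (R : Type*) [CRQSring R] : Prop extends IsDirected R where
  exists_idem : ∀ α : LamPos R, ∃ x : R, x * x = x ∧ ep x = α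

/-- A directed cr-qsring is spherically complete when every `x` lies on a monotone section
`φ : Λ → R` of `e⁺`. -/
def IsSphericallyComplete (R : Type*) [CRQSring R] : Prop :=
  ∀ x : R, ∃ φ : Lam R → R,
    (∀ α, ep (φ α) = α) ∧ (∀ α β, α ≤ β → φ α ≤ φ β) ∧ φ ⟨ep x, ep_idem x⟩ = x

section Directed

variable {R : Type*} [CRQSring R] [IsDirected R]

theorem v_le_self (x : R) : v x ≤ x := by
  have h := mul_le x (IsDirected.eps_le (eb x) (eb_idem x))
  rw [mul_eb, mul_comm] at h
  exact h

theorem meet_comm (x y : R) : meet x y = meet y x := by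
  unfold meet
  have h := le_def.1 (v_le_self (x + -y))
  rw [ep_of_idem (v_idem _)] at h
  have hx := add_of_le (v_idem _) (v_sub_le x y)
  rw [v_sub_comm x y]
  symm
  calc y + v (x + -y) = y + (x + -y + v (x + -y)) := by rw [← h]
    _ = x + (v (x + -y) + (y + -y)) := by ac_rfl
    _ = x + v (x + -y) := by
        have h2 := v_sub_le y x
        rw [v_sub_comm] at h2
        have := add_of_le (v_idem _) h2
        unfold ep at this
        rw [this]

theorem meet_le_right (x y : R) : meet x y ≤ y := by rw [meet_comm]; exact meet_le_left y x

theorem mul_meet (x y z : R) : x * meet y z = meet (x * y) (x * z) := by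
  apply le_antisymm
  · exact le_meet (mul_le x (meet_le_left y z)) (mul_le x (meet_le_right y z))
  · unfold meet
    have h : x * y + x * -z ≤ x * (y + -z) := quasi_distrib _ _ _
    rw [neg_mul_right]
    have h2 := v_le h
    rw [v_mul, ← mul_idem_eq x (v_idem _)] at h2
    refine le_trans ?_ (quasi_distrib x y (v (y + -z)))
    exact add_mono' le_rfl h2

/-- Multiplicative idempotents: the product is the meet. -/
theorem idem_mul_le {x y : R} (hx : x * x = x) (hy : y * y = y) : x * y ≤ x := by
  set m := meet x y with hm
  have hxm : x * m = meet x (x * y) := by rw [hm, mul_meet, hx]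
  have hym : y * m = meet (x * y) y := by rw [hm, mul_meet, hy, mul_comm y x]
  have hmm : m * m = meet (m * x) (m * y) := by conv_lhs => rw [hm, mul_meet, ← hm]
  have hle : m * m ≤ m := by
    apply le_meet
    · rw [hmm]
      refine (meet_le_left _ _).trans ?_
      rw [mul_comm, hxm]; exact meet_le_left _ _
    · rw [hmm]
      refine (meet_le_right _ _).trans ?_
      rw [mul_comm, hym]; exact meet_le_right _ _
  have hle2 : m * m ≤ x * y := by
    rw [hmm]
    refine (meet_le_left _ _).trans ?_
    rw [mul_comm, hxm]; exact meet_le_right _ _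
  have hxe : eps ≤ x := IsDirected.eps_le x hx
  have hye : eps ≤ y := IsDirected.eps_le y hy
  have hvm : v m = eps := by
    apply le_antisymm
    · have := v_le (meet_le_left x y); rwa [v_of_mul_idem hx] at this
    · have := v_le (le_meet hxe hye); rwa [v_of_idem eps_add] at this
  have hmi : m * m = m := by
    apply eq_of_le hle
    rw [ep_mul, hvm, eps_mul_idem (ep_idem m), ep_idem]
  rw [hmi] at hle2
  have h3 : x * y * m = x * y := by
    calc x * y * m = x * (y * m) := mul_assoc _ _ _
      _ = meet (x * (x * y)) (x * y) := by rw [hym, mul_meet]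
      _ = meet (x * y) (x * y) := by rw [← mul_assoc, hx]
      _ = x * y := le_antisymm (meet_le_left _ _) (le_meet le_rfl le_rfl)
  have hxy : x * y * (x * y) = x * y := by
    calc x * y * (x * y) = (x * x) * (y * y) := by ac_rfl
      _ = _ := by rw [hx, hy]
  have h4 : ep (x * y) ≤ ep m := by
    rw [← h3, ep_mul_of_mul_idem hxy hmi, add_comm]
    exact add_idem_le _ (ep_idem _)
  rw [← eq_of_le hle2 h4]
  exact meet_le_left _ _

theorem idem_le_idem {x y : R} (hx : x * x = x) (hy : y * y = y) (h : ep x ≤ ep y) : x ≤ y := by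
  have h1 : x * y = x := by
    apply eq_of_le (idem_mul_le hx hy)
    rw [ep_mul_of_mul_idem hx hy, add_of_le (ep_idem x) h]
  rw [← h1, mul_comm]
  exact idem_mul_le hy hx

theorem mul_idem_le (x : R) {y : R} (hy : y * y = y) : x * y ≤ x := by
  have h := mul_le x (idem_mul_le (eb_idem x) hy)
  rwa [← mul_assoc, mul_eb] at h

end Directed

/-- The carrier of `B(R)`: the inverse limit of the groups `R_α = {x | e⁺(x) = α}`, `α ∈ Λ₊`,
as the set of monotone sections over `Λ₊` of `e⁺`. -/
@[ext]
structure LimRing (R : Type*) [CRQSring R] where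
  toFun : LamPos R → R
  ep_toFun : ∀ α, ep (toFun α) = α
  mono : ∀ α β, α ≤ β → toFun α ≤ toFun β

namespace LimRing

variable {R : Type*} [CRQSring R]

instance : CoeFun (LimRing R) fun _ => LamPos R → R := ⟨toFun⟩

/-- `ε` as an element of `Λ₊`. -/
def e0 : LamPos R := ⟨eps, eps_add, le_rfl⟩

theorem v_e0_le (φ : LimRing R) : v (φ e0) ≤ eps := by
  have := v_le_ep (φ e0)
  rwa [φ.ep_toFun] at this

theorem eps_le_mul {f g : R} (hf : eps ≤ f) (hg : eps ≤ g) : eps ≤ f * g := by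
  have := mul_le' hf hg
  rwa [eps_mul] at this

/-- `α • v(φ(ε))⁻¹`, an element of `Λ₊`. -/
def shift (φ : LimRing R) (α : LamPos R) : LamPos R :=
  ⟨(α : R) * (v (φ e0))⁻¹, by
    refine ⟨mul_idem_mul _ (inv_add_idem (v_idem _)), eps_le_mul α.2.2 ?_⟩
    have h := mul_le (v (φ e0))⁻¹ (v_e0_le φ)
    rwa [mul_comm, eb_of_idem (v_idem _), mul_comm,
      eps_mul_idem (inv_add_idem (v_idem _))] at h⟩

/-- Multiplication on `Λ₊`. -/
def pmul (α β : LamPos R) : LamPos R :=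
  ⟨(α : R) * β, mul_idem_mul _ β.2.1, eps_le_mul α.2.2 β.2.2⟩

theorem le_pmul_left (α β : LamPos R) : α ≤ pmul α β := by
  have h := mul_le (α : R) β.2.2
  rw [mul_comm, eps_mul_idem α.2.1] at h
  exact h

theorem le_pmul_right (α β : LamPos R) : β ≤ pmul α β := by
  have h := mul_le (β : R) α.2.2
  rw [mul_comm, eps_mul_idem β.2.1, mul_comm] at h
  exact h

theorem e0_le (α : LamPos R) : (e0 : LamPos R) ≤ α := α.2.2

theorem add_eq {φ : LimRing R} {α β : LamPos R} (h : α ≤ β) : φ β + (α : R) = φ α := by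
  have := le_def.1 (φ.mono α β h)
  rw [φ.ep_toFun] at this
  exact this.symm

/-- The defining formula for the product is a lower bound with `e⁺ ≥ α`. -/
theorem le_ep_mul (φ ψ : LimRing R) (α γ δ : LamPos R) (hγ : shift ψ α ≤ γ) (hδ : shift φ α ≤ δ) :
    (α : R) ≤ ep (φ γ * ψ δ) := by
  have key : ∀ (φ ψ : LimRing R) (γ δ : LamPos R), shift φ α ≤ δ → (α : R) ≤ v (φ γ) * δ := by
    intro φ ψ γ δ h
    have h1 : v (φ e0) ≤ v (φ γ) := v_le (φ.mono _ _ (e0_le γ))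
    have h2 : (α : R) * (v (φ e0))⁻¹ ≤ δ := h
    refine le_trans (le_of_eq ?_) (mul_le' h1 h2)
    calc (α : R) = eps * α := (eps_mul_idem α.2.1).symm
      _ = v (φ e0) * (v (φ e0))⁻¹ * α := by rw [eb_of_idem (v_idem _)]
      _ = _ := by ac_rfl
  rw [ep_mul, ψ.ep_toFun, φ.ep_toFun]
  exact le_add α.2.1 (key φ ψ γ δ hδ) (key ψ φ δ γ hγ)

theorem ep_add_of_le {x : R} {α : LamPos R} (h : (α : R) ≤ ep x) : ep (x + α) = α := by
  rw [ep_add, ep_of_idem α.2.1, add_comm]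
  exact add_of_le α.2.1 h

/-- The product `(φψ)(α) = φ(α • v(ψ(ε))⁻¹) • ψ(α • v(φ(ε))⁻¹) + α`. -/
def mulFun (φ ψ : LimRing R) (α : LamPos R) : R :=
  φ (shift ψ α) * ψ (shift φ α) + α

theorem ep_mulFun (φ ψ : LimRing R) (α : LamPos R) : ep (mulFun φ ψ α) = α :=
  ep_add_of_le (le_ep_mul φ ψ α _ _ le_rfl le_rfl)

theorem eq_of_le_add {x y : R} {α : LamPos R} (hx : ep x = α) (h : x ≤ y + α) : x = y + α := by
  apply eq_of_le h
  rw [ep_add, ep_of_idem α.2.1, hx, add_comm]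
  exact add_idem_le _ (ep_idem y)

/-- The product as a limit. -/
theorem mulFun_eq (φ ψ : LimRing R) (α γ δ : LamPos R) (hγ : shift ψ α ≤ γ)
    (hδ : shift φ α ≤ δ) : mulFun φ ψ α = φ γ * ψ δ + α :=
  eq_of_le_add (ep_mulFun φ ψ α) (add_mono (mul_le' (φ.mono _ _ hγ) (ψ.mono _ _ hδ)) _)

theorem exists_large (φ ψ : LimRing R) (α : LamPos R) :
    ∃ γ, ∀ δ, γ ≤ δ → mulFun φ ψ α = φ δ * ψ δ + α :=
  ⟨pmul (shift ψ α) (shift φ α), fun δ h =>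
    mulFun_eq φ ψ α δ δ ((le_pmul_left _ _).trans h) ((le_pmul_right _ _).trans h)⟩

instance : Zero (LimRing R) := ⟨⟨fun α => α, fun α => ep_of_idem α.2.1, fun _ _ h => h⟩⟩

instance : Add (LimRing R) :=
  ⟨fun φ ψ => ⟨fun α => φ α + ψ α,
    fun α => by rw [ep_add, φ.ep_toFun, ψ.ep_toFun, α.2.1],
    fun α β h => add_mono' (φ.mono α β h) (ψ.mono α β h)⟩⟩

instance : Neg (LimRing R) :=
  ⟨fun φ => ⟨fun α => -φ α, fun α => by rw [ep_neg, φ.ep_toFun],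
    fun α β h => neg_le (φ.mono α β h)⟩⟩

instance : Mul (LimRing R) :=
  ⟨fun φ ψ => ⟨mulFun φ ψ, ep_mulFun φ ψ, fun α β h => by
    obtain ⟨γ, hγ⟩ := exists_large φ ψ α
    obtain ⟨δ, hδ⟩ := exists_large φ ψ β
    rw [hγ (pmul γ δ) (le_pmul_left _ _), hδ (pmul γ δ) (le_pmul_right _ _)]
    rw [add_comm _ (α : R), add_comm _ (β : R)]
    exact add_mono h _⟩⟩

theorem zero_apply (α : LamPos R) : (0 : LimRing R) α = α := rfl
theorem add_apply (φ ψ : LimRing R) (α : LamPos R) : (φ + ψ) α = φ α + ψ α := rfl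
theorem neg_apply (φ : LimRing R) (α : LamPos R) : (-φ) α = -φ α := rfl
theorem mul_apply (φ ψ : LimRing R) (α : LamPos R) :
    (φ * ψ) α = φ (shift ψ α) * ψ (shift φ α) + α := rfl

theorem mul_large (φ ψ : LimRing R) (α : LamPos R) :
    ∃ γ, ∀ δ, γ ≤ δ → (φ * ψ) α = φ δ * ψ δ + α := exists_large φ ψ α

protected theorem mul_comm' (φ ψ : LimRing R) : φ * ψ = ψ * φ := by
  ext α; rw [mul_apply, mul_apply, mul_comm]

theorem mul_mul_large (φ ψ χ : LimRing R) (α : LamPos R) :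
    ∃ γ, ∀ δ, γ ≤ δ → ((φ * ψ) * χ) α = φ δ * ψ δ * χ δ + α := by
  obtain ⟨γ, hγ⟩ := mul_large (φ * ψ) χ α
  obtain ⟨γ', hγ'⟩ := mul_large φ ψ γ
  refine ⟨pmul γ γ', fun δ h => ?_⟩
  have h1 : γ ≤ δ := (le_pmul_left _ _).trans h
  have h2 : γ' ≤ δ := (le_pmul_right _ _).trans h
  apply eq_of_le_add (((φ * ψ) * χ).ep_toFun α)
  rw [hγ γ le_rfl]
  refine add_mono (mul_le' ?_ (χ.mono _ _ h1)) _
  rw [hγ' δ h2]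
  exact add_idem_le _ γ.2.1

protected theorem mul_assoc' (φ ψ χ : LimRing R) : φ * ψ * χ = φ * (ψ * χ) := by
  ext α
  obtain ⟨γ, hγ⟩ := mul_mul_large φ ψ χ α
  obtain ⟨δ, hδ⟩ := mul_mul_large ψ χ φ α
  rw [LimRing.mul_comm' φ (ψ * χ), hγ (pmul γ δ) (le_pmul_left _ _),
    hδ (pmul γ δ) (le_pmul_right _ _)]
  congr 1
  ac_rfl

protected theorem mul_add' (φ ψ χ : LimRing R) : φ * (ψ + χ) = φ * ψ + φ * χ := by
  ext α
  obtain ⟨γ, hγ⟩ := mul_large φ (ψ + χ) α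
  obtain ⟨δ, hδ⟩ := mul_large φ ψ α
  obtain ⟨ζ, hζ⟩ := mul_large φ χ α
  let μ := pmul γ (pmul δ ζ)
  have h1 : γ ≤ μ := le_pmul_left _ _
  have h2 : δ ≤ μ := (le_pmul_left δ ζ).trans (le_pmul_right _ _)
  have h3 : ζ ≤ μ := (le_pmul_right δ ζ).trans (le_pmul_right _ _)
  symm
  rw [hγ μ h1]
  apply eq_of_le_add ((φ * ψ + φ * χ).ep_toFun α)
  rw [add_apply, hδ μ h2, hζ μ h3, add_apply]
  have e : φ μ * ψ μ + (α : R) + (φ μ * χ μ + α) = (φ μ * ψ μ + φ μ * χ μ) + α := by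
    calc _ = (φ μ * ψ μ + φ μ * χ μ) + ((α : R) + α) := by ac_rfl
      _ = _ := by rw [α.2.1]
  rw [e]
  exact add_mono (quasi_distrib _ _ _) _

section Unital

variable [IsSuperrigid R]

/-- The element `1_α`: the idempotent `x ∈ E•` with `e⁺(x) = α`. -/
noncomputable def oneAt (α : LamPos R) : R := (IsSuperrigid.exists_idem α).choose

theorem oneAt_idem (α : LamPos R) : oneAt α * oneAt α = oneAt α :=
  (IsSuperrigid.exists_idem α).choose_spec.1

theorem ep_oneAt (α : LamPos R) : ep (oneAt α) = α :=
  (IsSuperrigid.exists_idem α).choose_spec.2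

/-- `1_α` is the only element of `E•` with `e⁺ = α`. -/
theorem oneAt_unique {α : LamPos R} {x : R} (hx : x * x = x) (h : ep x = α) : x = oneAt α :=
  le_antisymm (idem_le_idem hx (oneAt_idem α) (by rw [h, ep_oneAt]))
    (idem_le_idem (oneAt_idem α) hx (by rw [h, ep_oneAt]))

noncomputable instance : One (LimRing R) :=
  ⟨⟨oneAt, ep_oneAt, fun α β h => idem_le_idem (oneAt_idem α) (oneAt_idem β)
    (by rw [ep_oneAt, ep_oneAt]; exact h)⟩⟩

theorem one_apply (α : LamPos R) : (1 : LimRing R) α = oneAt α := rfl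

protected theorem mul_one' (φ : LimRing R) : φ * 1 = φ := by
  ext α
  obtain ⟨γ, hγ⟩ := mul_large φ 1 α
  have h1 : γ ≤ pmul γ α := le_pmul_left _ _
  have h2 : α ≤ pmul γ α := le_pmul_right _ _
  refine Eq.trans ?_ (add_eq (φ := φ) h2)
  apply eq_of_le_add ((φ * 1).ep_toFun α)
  rw [hγ _ h1]
  exact add_mono (mul_idem_le _ (oneAt_idem _)) _

/-- The commutative ring `B(R)` associated to a superrigid directed cr-qsring `R`. -/
noncomputable instance : CommRing (LimRing R) where
  add_assoc φ ψ χ := by ext α; exact add_assoc _ _ _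
  zero_add φ := by
    ext α; rw [add_apply, zero_apply, ← φ.ep_toFun α, ep_add_self]
  add_zero φ := by
    ext α; rw [add_apply, zero_apply, ← φ.ep_toFun α, add_ep_self]
  add_comm φ ψ := by ext α; exact add_comm _ _
  neg_add_cancel φ := by
    ext α; rw [add_apply, neg_apply, zero_apply, add_comm]; exact φ.ep_toFun α
  nsmul := nsmulRec
  zsmul := zsmulRec
  mul_assoc := LimRing.mul_assoc'
  mul_comm := LimRing.mul_comm'
  one_mul φ := by rw [LimRing.mul_comm']; exact LimRing.mul_one' φ
  mul_one := LimRing.mul_one'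
  left_distrib := LimRing.mul_add'
  right_distrib φ ψ χ := by
    rw [LimRing.mul_comm', LimRing.mul_add', LimRing.mul_comm' χ φ, LimRing.mul_comm' χ ψ]
  zero_mul φ := by
    ext α
    have h : ∀ γ δ : LamPos R, ((0 : LimRing R) γ * φ δ) + ((0 : LimRing R) γ * φ δ) =
        (0 : LimRing R) γ * φ δ := by
      intro γ δ; rw [zero_apply, mul_comm]; exact mul_idem_mul _ γ.2.1
    have h2 := (0 * φ).ep_toFun α
    rw [mul_apply, ep_of_idem (idem_add (h _ _) α.2.1)] at h2
    rw [mul_apply, h2, zero_apply]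
  mul_zero φ := by
    rw [LimRing.mul_comm']
    ext α
    have h : ∀ γ δ : LamPos R, ((0 : LimRing R) γ * φ δ) + ((0 : LimRing R) γ * φ δ) =
        (0 : LimRing R) γ * φ δ := by
      intro γ δ; rw [zero_apply, mul_comm]; exact mul_idem_mul _ γ.2.1
    have h2 := (0 * φ).ep_toFun α
    rw [mul_apply, ep_of_idem (idem_add (h _ _) α.2.1)] at h2
    rw [mul_apply, h2, zero_apply]

end Unital

/-- The `l`-valuation `w(φ) = v ∘ φ : Λ₊ → Λ`. -/
def w (φ : LimRing R) (α : LamPos R) : Lam R := ⟨v (φ α), v_idem _⟩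

section ValuationRing

variable [IsSuperrigid R]

/-- The `l`-valuation ring `A = {φ ∈ B(R) | w(φ) ≥ ε}`. -/
noncomputable def valRing (R : Type*) [CRQSring R] [IsSuperrigid R] : Subring (LimRing R) where
  carrier := {φ | ∀ α, eps ≤ (w φ α : R)}
  mul_mem' {φ ψ} hφ hψ α := by
    obtain ⟨γ, hγ⟩ := mul_large φ ψ α
    change eps ≤ v ((φ * ψ) α)
    rw [hγ γ le_rfl]
    refine le_trans ?_ (v_add _ _)
    rw [v_mul, v_of_idem α.2.1]
    exact le_add eps_add (eps_le_mul (hφ γ) (hψ γ)) α.2.2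
  one_mem' α := by
    change eps ≤ v (oneAt α)
    rw [v_of_mul_idem (oneAt_idem α)]
  add_mem' {φ ψ} hφ hψ α := (le_add eps_add (hφ α) (hψ α)).trans (v_add _ _)
  zero_mem' α := by
    change eps ≤ v (α : R)
    rw [v_of_idem α.2.1]; exact α.2.2
  neg_mem' {φ} hφ α := by
    change eps ≤ v (-φ α)
    rw [v_neg]; exact hφ α

/-- `A = {φ ∈ B(R) | φ(ε) = ε}`. -/
theorem mem_valRing_iff (φ : LimRing R) : φ ∈ valRing R ↔ φ e0 = eps := by
  constructor
  · intro h
    have h1 : (eps : R) ≤ φ e0 := (h e0).trans (v_le_self _)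
    exact (eq_of_le h1 (by rw [φ.ep_toFun, ep_of_idem eps_add]; exact le_rfl)).symm
  · intro h α
    have h1 := v_le (φ.mono _ _ (e0_le α))
    rwa [h, v_of_idem eps_add] at h1

end ValuationRing

end LimRing

end CRQSring

/-- For a subring `A` of a commutative ring `B`: the `B`-invertible `A`-submodules of `B`, i.e.
those `I` with `I J = A` for some `A`-submodule `J` of `B`. -/
def invertibleSubmodules {B : Type*} [CommRing B] (A : Subring B) : Set (Submodule A B) :=
  {I | ∃ J : Submodule A B, I * J = 1}

/-- The finitely generated `B`-regular `A`-submodules of `B`, i.e. those with `I B = B`. -/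
def regularFGSubmodules {B : Type*} [CommRing B] (A : Subring B) : Set (Submodule A B) :=
  {I | I.FG ∧ Ideal.span (I : Set B) = ⊤}

/-- `A ⊆ B` is a Prüfer extension: the invertible `A`-submodules of `B` are exactly the finitely
generated `B`-regular ones. -/
def IsPruferExtension {B : Type*} [CommRing B] (A : Subring B) : Prop :=
  invertibleSubmodules A = regularFGSubmodules A

/-! That an invertible submodule is finitely generated and `B`-regular is general ring theory. For
the converse, filter `B` by the `A`-submodules `level f` (`f ∈ Λ`) of elements of value at least
`f`; here `level 1 = A` and `level f * level g ≤ level (f * g)`. The inverse of a finitely generated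
regular `I` will be `level m⁻¹`, where `m` is a meet of approximate values of generators of `I`.

Spherical completeness turns quasi-inverses in `R` into elements of `B`, and is used twice. It
splits levels, `level (f ⊓ g) ≤ level f ⊔ level g` (`level_inf_le`), by producing comaximality of
levels with meet `ε`. It also inverts each `φ ∈ B` up to an error: lifting `(φ δ)⁻¹` gives `ψ` with
`1 - φ * ψ` of value at least `δ • v(φ δ)⁻¹` (`exists_one_sub_mul_mem_level`).

Together these give, for `I` generated by a finite set and any `δ`, an `m` with `I ≤ level m` and
`level (m * t) ≤ I * level t ⊔ level (δ * t)` for all `t`. Regularity, `1 ∈ I B`, gives a `g` with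
`level (g * t) ≤ I * level t`. Choosing `δ ≥ g` absorbs the error term, and `t = m⁻¹` yields `A ≤ I
* level m⁻¹ ≤ level m * level m⁻¹ ≤ A`. -/

namespace CRQSring

/-! ### The lattice-ordered group `Λ` of additive idempotents -/

section LatticeOrderedGroup

variable {R : Type*} [CRQSring R]

/-- The additive idempotents form an Abelian group under `•`. -/
instance : CommGroup (Lam R) where
  mul f g := ⟨f * g, mul_idem_mul _ g.2⟩
  one := ⟨eps, eps_add⟩
  inv f := ⟨(f : R)⁻¹, inv_add_idem f.2⟩
  mul_assoc _ _ _ := Subtype.ext (mul_assoc _ _ _)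
  mul_comm _ _ := Subtype.ext (mul_comm _ _)
  one_mul f := Subtype.ext (eps_mul_idem f.2)
  mul_one f := Subtype.ext ((mul_comm _ _).trans (eps_mul_idem f.2))
  inv_mul_cancel f := Subtype.ext ((mul_comm _ _).trans (eb_of_idem f.2))

/-- Addition is the meet on the additive idempotents. -/
instance : SemilatticeInf (Lam R) where
  inf f g := ⟨f + g, idem_add f.2 g.2⟩
  inf_le_left f g := add_idem_le (f : R) g.2
  inf_le_right f g := (add_comm (f : R) g).trans_le (add_idem_le (g : R) f.2)
  le_inf f _ _ := le_add f.2

instance : IsOrderedMonoid (Lam R) where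
  mul_le_mul_left _ _ h f := mul_le' (R := R) h (le_refl (f : R))

theorem inf_mul_eq (f g h : Lam R) : (f ⊓ g) * h = f * h ⊓ g * h := by
  refine Subtype.ext ?_
  change ((f : R) + g) * h = f * h + g * h
  rw [mul_comm, mul_idem_add _ f.2 g.2, mul_comm (h : R), mul_comm (h : R)]

/-- The quasivaluation with values in `Λ`. -/
def vLam (x : R) : Lam R := ⟨v x, v_idem x⟩

/-- The map `e⁺` with values in `Λ`. -/
def epLam (x : R) : Lam R := ⟨ep x, ep_idem x⟩

theorem vLam_mono {x y : R} (h : x ≤ y) : vLam x ≤ vLam y := v_le h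

theorem vLam_mul (x y : R) : vLam (x * y) = vLam x * vLam y := Subtype.ext (v_mul x y)

theorem vLam_inv (x : R) : vLam x⁻¹ = (vLam x)⁻¹ := Subtype.ext (v_inv x).symm

theorem vLam_coe (f : Lam R) : vLam (f : R) = f := Subtype.ext (v_of_idem f.2)

theorem inf_le_vLam_add (x y : R) : vLam x ⊓ vLam y ≤ vLam (x + y) := v_add x y

theorem vLam_le_epLam (x : R) : vLam x ≤ epLam x := v_le_ep x

/-- Since a multiplicative idempotent is determined by its `e⁺`, this identifies `x • x⁻¹` as a
specific `1_α`. -/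
theorem epLam_eb (x : R) : epLam (eb x) = epLam x * (vLam x)⁻¹ := by
  rw [eq_mul_inv_iff_mul_eq, mul_comm]
  exact Subtype.ext (ep_eq x).symm

/-- An element of `Λ` that is at least `ε`, as an element of `Λ₊`. -/
def toLamPos (f : Lam R) (h : 1 ≤ f) : LamPos R := ⟨f, f.2, h⟩

/-- The inclusion of `Λ₊` in `Λ`. -/
def ofLamPos (α : LamPos R) : Lam R := ⟨α, α.2.1⟩

theorem exists_lamPos_ge (f : Lam R) : ∃ α : LamPos R, (f : R) ≤ α := by
  -- The join of `f` and `ε`, written through the meet by inversion.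
  have h : 1 ≤ (f⁻¹ ⊓ 1)⁻¹ := one_le_inv'.2 inf_le_right
  exact ⟨toLamPos _ h, (le_inv'.2 inf_le_left : f ≤ (f⁻¹ ⊓ 1)⁻¹)⟩

end LatticeOrderedGroup

namespace LimRing

/-! ### The filtration of `B` by value -/

section Level

variable {R : Type*} [CRQSring R]

theorem le_mul_apply (φ ψ : LimRing R) (α γ : LamPos R) :
    ∃ δ, γ ≤ δ ∧ (φ * ψ) α = φ δ * ψ δ + α := by
  obtain ⟨δ, hδ⟩ := mul_large φ ψ α
  exact ⟨pmul γ δ, le_pmul_left _ _, hδ _ (le_pmul_right _ _)⟩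

theorem mul_mem_level {φ ψ : LimRing R} {f g : Lam R} (hφ : ∃ δ, f ≤ vLam (φ δ))
    (hψ : ∃ δ, g ≤ vLam (ψ δ)) : ∃ δ, f * g ≤ vLam ((φ * ψ) δ) := by
  obtain ⟨δ, hδ⟩ := hφ
  obtain ⟨δ', hδ'⟩ := hψ
  -- Taking `α` above `f * g` keeps the summand `α` in the product formula from lowering the value.
  obtain ⟨α, hα⟩ := exists_lamPos_ge (f * g)
  obtain ⟨κ, hκ, e⟩ := le_mul_apply φ ψ α (pmul δ δ')
  refine ⟨α, ?_⟩
  rw [e]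
  refine le_trans (le_inf ?_ ?_) (inf_le_vLam_add _ _)
  · rw [vLam_mul]
    exact mul_le_mul' (hδ.trans (vLam_mono (φ.mono _ _ ((le_pmul_left _ _).trans hκ))))
      (hδ'.trans (vLam_mono (ψ.mono _ _ ((le_pmul_right _ _).trans hκ))))
  · exact le_of_le_of_eq (show f * g ≤ ofLamPos α from hα) (vLam_coe (ofLamPos α)).symm

/-- Over a spherically complete cr-qsring, every element lies below an element of `B(R)`. -/
theorem exists_lift (hc : IsSphericallyComplete R) (x : R) :
    ∃ ψ : LimRing R, ∀ δ : LamPos R, ep x ≤ δ → x ≤ ψ δ := by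
  obtain ⟨φ, h1, h2, h3⟩ := hc x
  refine ⟨⟨fun α => φ (ofLamPos α), fun α => h1 _, fun α β h => h2 _ _ h⟩, fun δ h => ?_⟩
  conv_lhs => rw [← h3]
  exact h2 _ _ h

variable [IsSuperrigid R]

theorem mem_valRing_iff_exists {φ : LimRing R} : φ ∈ valRing R ↔ ∃ δ, 1 ≤ vLam (φ δ) := by
  refine ⟨fun h => ⟨e0, h e0⟩, fun ⟨δ, h⟩ α => ?_⟩
  change 1 ≤ vLam (φ α)
  -- Write `φ α` as `φ (α • δ) + α`: the first term inherits its bound from `δ` by monotonicity, and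
  -- `α ≥ ε`.
  rw [← add_eq (φ := φ) (le_pmul_left α δ)]
  refine le_trans (le_inf (h.trans (vLam_mono (φ.mono _ _ (le_pmul_right α δ)))) ?_)
    (inf_le_vLam_add _ _)
  exact le_of_le_of_eq (show 1 ≤ ofLamPos α from α.2.2) (vLam_coe (ofLamPos α)).symm

/-- The `A`-submodule of `B(R)` of the elements with value at least `f`. -/
noncomputable def level (f : Lam R) : Submodule (valRing R) (LimRing R) where
  -- The value at `δ` increases with `δ` but never exceeds `δ`, so a bound by a general `f` can only
  -- be asked at some index.
  carrier := {φ | ∃ δ, f ≤ vLam (φ δ)}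
  zero_mem' := by
    obtain ⟨α, hα⟩ := exists_lamPos_ge f
    exact ⟨α, le_of_le_of_eq (show f ≤ ofLamPos α from hα) (vLam_coe (ofLamPos α)).symm⟩
  add_mem' := by
    rintro φ ψ ⟨δ, hδ⟩ ⟨δ', hδ'⟩
    refine ⟨pmul δ δ', le_trans (le_inf ?_ ?_) (inf_le_vLam_add _ _)⟩
    · exact hδ.trans (vLam_mono (φ.mono _ _ (le_pmul_left _ _)))
    · exact hδ'.trans (vLam_mono (ψ.mono _ _ (le_pmul_right _ _)))
  smul_mem' a φ h := by
    obtain ⟨δ, hδ⟩ := mul_mem_level (mem_valRing_iff_exists.1 a.2) h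
    exact ⟨δ, by rwa [one_mul] at hδ⟩

theorem mem_level {f : Lam R} {φ : LimRing R} : φ ∈ level f ↔ ∃ δ, f ≤ vLam (φ δ) := Iff.rfl

theorem level_anti {f g : Lam R} (h : f ≤ g) : level g ≤ level f :=
  fun _ ⟨δ, hδ⟩ => ⟨δ, h.trans hδ⟩

theorem mul_mem_level_mul {f g : Lam R} {φ ψ : LimRing R} (hφ : φ ∈ level f)
    (hψ : ψ ∈ level g) : φ * ψ ∈ level (f * g) :=
  mul_mem_level hφ hψ

theorem level_mul_le (f g : Lam R) : level f * level g ≤ level (f * g) :=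
  Submodule.mul_le.2 fun _ h _ h' => mul_mem_level_mul h h'

theorem level_one : level (1 : Lam R) = 1 := by
  ext φ
  rw [mem_level, ← mem_valRing_iff_exists, Submodule.mem_one]
  exact ⟨fun h => ⟨⟨φ, h⟩, rfl⟩, fun ⟨a, h⟩ => h ▸ a.2⟩

/-! ### Lifting quasi-inverses: comaximality and approximate inverses -/

/-- Subtracting the two inequalities gives `α = 1_α - 1_α ≤ x - y`; then apply `v`. Lying above
`1_α` thus means being congruent to `1` modulo value `α`. -/
theorem le_of_le_of_oneAt {α : LamPos R} {x y : R} (hx : oneAt α ≤ x) (hy : oneAt α ≤ y) :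
    ofLamPos α ≤ vLam (x + -y) := by
  have h : (α : R) ≤ x + -y := by
    rw [← ep_oneAt α]
    exact add_mono' hx (neg_le hy)
  rw [← vLam_coe (ofLamPos α)]
  exact vLam_mono h

theorem oneAt_mono {α β : LamPos R} (h : α ≤ β) : oneAt α ≤ oneAt β :=
  (1 : LimRing R).mono α β h

/-- Elements of `Λ₊` with meet `ε` give comaximal ideals. -/
theorem exists_mem_level_one_sub_mem_level (hc : IsSphericallyComplete R) {f g : Lam R}
    (hf : 1 ≤ f) (hg : 1 ≤ g) (h : f ⊓ g = 1) : ∃ c ∈ level g, 1 - c ∈ level f := by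
  let α := toLamPos f hf
  -- Truncating `1_f` at `f • g⁻¹` lowers its value to `g⁻¹` while keeping `x • x⁻¹ = 1_f`. Hence
  -- `x⁻¹` has value `g` and still lies above `1_f`; any lift of it is the required `c`.
  let x : R := oneAt α + (f * g⁻¹ : Lam R)
  have hx1 : x ≤ oneAt α := add_idem_le _ (f * g⁻¹).2
  have hep : epLam x = f * g⁻¹ := by
    refine Subtype.ext ?_
    change ep x = _
    rw [ep_add, ep_oneAt, ep_of_idem (f * g⁻¹).2]
    exact congrArg Subtype.val
      (inf_eq_right.2 (mul_le_of_le_one_right' (inv_le_one'.2 hg)) : f ⊓ f * g⁻¹ = f * g⁻¹)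
  have hone : vLam (oneAt α) = 1 := Subtype.ext (v_of_mul_idem (oneAt_idem α))
  have hmeet : 1 ⊓ f * g⁻¹ = g⁻¹ := by
    rw [← mul_inv_cancel g, ← inf_mul_eq, inf_comm, h, one_mul]
  have hv : vLam x = g⁻¹ := by
    rw [← hmeet]
    apply le_antisymm
    · refine le_inf ((vLam_mono hx1).trans hone.le) ((vLam_le_epLam x).trans hep.le)
    · have := inf_le_vLam_add (oneAt α) ((f * g⁻¹ : Lam R) : R)
      rwa [hone, vLam_coe] at this
  have heb : eb x = oneAt α := by
    refine oneAt_unique (eb_idem x) ?_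
    have := epLam_eb x
    rw [hep, hv, mul_inv_cancel_right] at this
    exact congrArg Subtype.val this
  -- `1_α = x • x⁻¹ ≤ 1_α • x⁻¹ ≤ x⁻¹`.
  have hy : oneAt α ≤ x⁻¹ := by
    rw [← heb]
    refine (mul_le' hx1 le_rfl).trans ?_
    rw [mul_comm]
    exact mul_idem_le _ (oneAt_idem α)
  obtain ⟨c, hcx⟩ := exists_lift hc x⁻¹
  obtain ⟨δ, hδ⟩ := exists_lamPos_ge (epLam x⁻¹)
  refine ⟨c, ⟨δ, ?_⟩, ⟨pmul α δ, ?_⟩⟩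
  · refine le_trans (le_of_eq ?_) (vLam_mono (hcx δ hδ))
    rw [vLam_inv, hv, inv_inv]
  · rw [sub_eq_add_neg]
    exact le_of_le_of_oneAt (oneAt_mono (le_pmul_left α δ))
      (hy.trans (hcx _ (hδ.trans (le_pmul_right α δ))))

/-- Dividing `f` and `g` by their meet makes the meet `ε`; the resulting partition `1 = (1 - c) + c`
then multiplies `φ` into the two levels. -/
theorem level_inf_le (hc : IsSphericallyComplete R) (f g : Lam R) :
    level (f ⊓ g) ≤ level f ⊔ level g := by
  intro φ hφ
  obtain ⟨c, hg, hf⟩ := exists_mem_level_one_sub_mem_level hc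
    (f := f * (f ⊓ g)⁻¹) (g := g * (f ⊓ g)⁻¹) (le_mul_inv_iff_mul_le.2 (by simp))
    (le_mul_inv_iff_mul_le.2 (by simp)) (by rw [← inf_mul_eq, mul_inv_cancel])
  have e : φ = (1 - c) * φ + c * φ := by ring
  rw [e]
  refine Submodule.add_mem_sup ?_ ?_
  · simpa using mul_mem_level_mul hf hφ
  · simpa using mul_mem_level_mul hg hφ

/-- Every element of `B(R)` is invertible up to an error of large value. -/
theorem exists_one_sub_mul_mem_level (hc : IsSphericallyComplete R) (φ : LimRing R)
    (δ : LamPos R) : ∃ ψ ∈ level (vLam (φ δ))⁻¹,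
      1 - φ * ψ ∈ level (ofLamPos δ * (vLam (φ δ))⁻¹) := by
  have hep : epLam (φ δ) = ofLamPos δ := Subtype.ext (φ.ep_toFun δ)
  have hpos : 1 ≤ ofLamPos δ * (vLam (φ δ))⁻¹ := by
    rw [le_mul_inv_iff_mul_le, one_mul, ← hep]
    exact vLam_le_epLam _
  -- `α` is `e⁺` of `φ δ • (φ δ)⁻¹`, so that idempotent is `1_α`. The product of `φ` with a lift of
  -- `(φ δ)⁻¹` lies above it at large indices, hence is `1` modulo value `α`.
  let α := toLamPos _ hpos
  have heb : eb (φ δ) = oneAt α := by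
    refine oneAt_unique (eb_idem _) ?_
    have := epLam_eb (φ δ)
    rw [hep] at this
    exact congrArg Subtype.val this
  obtain ⟨ψ, hψ⟩ := exists_lift hc (φ δ)⁻¹
  obtain ⟨γ, hγ⟩ := exists_lamPos_ge (epLam (φ δ)⁻¹)
  refine ⟨ψ, ⟨γ, ?_⟩, ⟨α, ?_⟩⟩
  · rw [← vLam_inv]
    exact vLam_mono (hψ γ hγ)
  · obtain ⟨κ, hκ, e⟩ := le_mul_apply φ ψ α (pmul δ γ)
    rw [sub_eq_add_neg]
    refine le_of_le_of_oneAt (x := oneAt α) (y := (φ * ψ) α) le_rfl ?_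
    rw [e]
    calc oneAt α = oneAt α + α := by
          conv_rhs => rw [← ep_oneAt α, add_ep_self]
      _ ≤ φ κ * ψ κ + α := by
          refine add_mono ?_ _
          rw [← heb]
          exact mul_le' (φ.mono _ _ ((le_pmul_left _ _).trans hκ))
            (hψ κ (hγ.trans ((le_pmul_right δ γ).trans hκ)))

/-! ### Finitely generated and regular submodules -/

/-- `m` is the meet of `δ` and the values `v(φ δ)` for `φ ∈ s`. Splitting levels along this meet
reduces the inclusion to one generator at a time, where its approximate inverse applies. -/
theorem exists_level_le_span_mul_sup (hc : IsSphericallyComplete R) (s : Finset (LimRing R))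
    (δ : LamPos R) : ∃ m : Lam R, (∀ φ ∈ s, φ ∈ level m) ∧
      ∀ t, level (m * t) ≤ Submodule.span (valRing R) (s : Set (LimRing R)) * level t ⊔
        level (ofLamPos δ * t) := by
  classical
  induction s using Finset.induction_on with
  -- With no generators, `m = δ` lets the error term alone cover the level.
  | empty => exact ⟨ofLamPos δ, by simp, fun t => le_sup_right⟩
  | insert φ s _ ih =>
    obtain ⟨m, h1, h2⟩ := ih
    refine ⟨vLam (φ δ) ⊓ m, fun χ hχ => ?_, fun t => ?_⟩
    · rcases Finset.mem_insert.1 hχ with rfl | hχ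
      · exact ⟨δ, inf_le_left⟩
      · exact level_anti inf_le_right (h1 χ hχ)
    · rw [inf_mul_eq]
      refine (level_inf_le hc _ _).trans (sup_le ?_ ((h2 t).trans (sup_le_sup_right
        (Submodule.smul_mono_left (Submodule.span_mono (by simp))) _)))
      intro χ hχ
      obtain ⟨ψ, hψ, hu⟩ := exists_one_sub_mul_mem_level hc φ δ
      -- As `χ` has value at least `v(φ δ) * t`, the factor `ψ * χ` lies in `level t` and the error
      -- in `level (δ * t)`.
      have e : χ = φ * (ψ * χ) + (1 - φ * ψ) * χ := by ring
      rw [e]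
      refine Submodule.add_mem_sup (Submodule.mul_mem_mul (Submodule.subset_span (by simp)) ?_) ?_
      · simpa using mul_mem_level_mul hψ hχ
      · simpa [mul_assoc] using mul_mem_level_mul hu hχ

theorem exists_level_le_mul_level {I : Submodule (valRing R) (LimRing R)}
    (hI : Ideal.span (I : Set (LimRing R)) = ⊤) :
    ∃ g : Lam R, ∀ t, level (g * t) ≤ I * level t := by
  -- Generalised from `1` to every `b ∈ I B`, so that span induction applies; `g` must not depend on
  -- `t`.
  suffices h : ∀ b ∈ Ideal.span (I : Set (LimRing R)),
      ∃ g : Lam R, ∀ t, ∀ χ ∈ level (g * t), b * χ ∈ I * level t by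
    obtain ⟨g, hg⟩ := h 1 (hI ▸ Submodule.mem_top)
    exact ⟨g, fun t χ hχ => by simpa using hg t χ hχ⟩
  intro b hb
  induction hb using Submodule.span_induction with
  | mem b hb => exact ⟨1, fun t χ hχ => Submodule.mul_mem_mul hb (by rwa [one_mul] at hχ)⟩
  | zero => exact ⟨1, fun t χ _ => by simp⟩
  | add b b' _ _ h h' =>
    obtain ⟨g, hg⟩ := h
    obtain ⟨g', hg'⟩ := h'
    -- The join of `g` and `g'`.
    refine ⟨(g⁻¹ ⊓ g'⁻¹)⁻¹, fun t χ hχ => ?_⟩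
    rw [add_mul]
    refine add_mem (hg t χ (level_anti ?_ hχ)) (hg' t χ (level_anti ?_ hχ))
    · exact mul_le_mul_left (le_inv'.2 inf_le_left) t
    · exact mul_le_mul_left (le_inv'.2 inf_le_right) t
  | smul a b _ h =>
    obtain ⟨g, hg⟩ := h
    -- Multiplication by `a` can lower values, but by no more than its value at `ε`; the factor
    -- compensates for that.
    refine ⟨g * (vLam (a e0))⁻¹, fun t χ hχ => ?_⟩
    rw [smul_eq_mul, mul_comm a, mul_assoc]
    refine hg t _ ?_
    have ha : a ∈ level (vLam (a e0)) := ⟨e0, le_rfl⟩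
    convert mul_mem_level_mul ha hχ using 2
    rw [mul_right_comm g, mul_comm _ (vLam (a e0))⁻¹, mul_inv_cancel_left]

/-- A finitely generated `B`-regular submodule is invertible. -/
theorem exists_mul_eq_one (hc : IsSphericallyComplete R)
    {I : Submodule (valRing R) (LimRing R)} (hfg : I.FG)
    (hI : Ideal.span (I : Set (LimRing R)) = ⊤) :
    ∃ J : Submodule (valRing R) (LimRing R), I * J = 1 := by
  obtain ⟨g, hg⟩ := exists_level_le_mul_level hI
  -- With `δ ≥ g`, the error `level (δ * m⁻¹)` is contained in `I * level m⁻¹`.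
  obtain ⟨δ, hδ⟩ := exists_lamPos_ge g
  obtain ⟨s, rfl⟩ := hfg
  obtain ⟨m, h1, h2⟩ := exists_level_le_span_mul_sup hc s δ
  refine ⟨level m⁻¹, le_antisymm ?_ ?_⟩
  · rw [← level_one, ← mul_inv_cancel m]
    exact (Submodule.smul_mono_left (Submodule.span_le.2 h1)).trans (level_mul_le _ _)
  · rw [← level_one, ← mul_inv_cancel m]
    refine (h2 m⁻¹).trans (sup_le le_rfl ?_)
    exact (level_anti (mul_le_mul_left (show g ≤ ofLamPos δ from hδ) _)).trans (hg _)

end Level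

end LimRing

end CRQSring

/-! ### The general direction and the conclusion -/

/-- Units among submodules are finitely generated, and `1 ∈ I * J` already lies in `I B`. -/
theorem mem_regularFGSubmodules_of_mul_eq_one {B : Type*} [CommRing B] {A : Subring B}
    {I J : Submodule A B} (h : I * J = 1) : I ∈ regularFGSubmodules A := by
  refine ⟨Submodule.fg_of_isUnit (IsUnit.of_mul_eq_one J h), ?_⟩
  rw [Ideal.eq_top_iff_one]
  have h1 : (1 : B) ∈ I * J := h ▸ Submodule.one_le.1 le_rfl
  exact Submodule.mul_induction_on h1
    (fun m hm n _ => Ideal.mul_mem_right n _ (Ideal.subset_span hm)) fun _ _ hx hy => add_mem hx hy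

theorem corollary6p9 (R : Type*) [CRQSring R] [CRQSring.IsSuperrigid R]
    (hc : CRQSring.IsSphericallyComplete R) :
    IsPruferExtension (CRQSring.LimRing.valRing R) := by
  ext I
  exact ⟨fun ⟨_, h⟩ => mem_regularFGSubmodules_of_mul_eq_one h,
    fun ⟨hfg, hI⟩ => CRQSring.LimRing.exists_mul_eq_one hc hfg hI⟩
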